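/- For integers $r\ge 1$ and $c=(c_1,\dots,c_r)$ with $c_i\ge 0$ and $c_1+\cdots+c_r\geq 1$, a cylindric partition with profile $c$ is a tuple $\Lambda=(\lambda^{(1)},\dots,\lambda^{(r)})$ of ordinary partitions $\lambda^{(i)}=(\lambda^{(i)}_1\ge\lambda^{(i)}_2\ge\cdots)$, each padded with zeros, such that $\lambda^{(i)}_j\ge\lambda^{(i+1)}_{j+c_{i+1}}$ for $1\le i<r$ and $\lambda^{(r)}_j\ge\lambda^{(1)}_{j+c_1}$, for all $j\ge 1$. Let $|\Lambda|$ be the sum of all parts of $\lambda^{(1)},\dots,\lambda^{(r)}$, let $\max(\Lambda)$ be the largest of these parts ($0$ if there are none), and let $F_c(z,q)=\sum_{\Lambda}z^{\max(\Lambda)}q^{|\Lambda|}$, the sum being over all cylindric partitions with profile $c$. Write $(a;q)_n=\prod_{k=1}^{n}(1-aq^{k-1})$ and $(a;q)_\infty=\lim_{n\to\infty}(a;q)_n$. Then for every $q\in\mathbb{C}$ with $|q|<1$, the sum defining $F_{(1,0,1,0)}(1,q)$ converges absolutely, the series and infinite products below converge, no denominator below vanishes, and $$F_{(1,0,1,0)}(1,q)=\left(1+\sum_{n\ge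 1}\frac{2\,q^{n(n+1)}\,(-q^2;q^2)_{n-1}}{(q^2;q^2)_n\,(-q;q^2)_n}\right)\cdot\frac{(-q;q^2)_\infty}{(q;q)_\infty}.$$ -/

import Mathlib

open Filter Topology

/-- A cylindric partition of rank `r` with profile `c`. The `i`-th ordinary partition is given by
its sequence of parts `row i 0 ≥ row i 1 ≥ ⋯`, padded with zeros (so it is a non-increasing,
finitely supported sequence of natural numbers). Rows and profile are indexed cyclically by
`Fin r`; in particular `i + 1` is the first index when `i` is the last one. -/
@[ext]
structure CylindricPartition {r : ℕ} [NeZero r] (c : Fin r → ℕ) where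
  row : Fin r → ℕ →₀ ℕ
  antitone_row : ∀ i, Antitone (row i)
  le_row : ∀ i j, row (i + 1) (j + c (i + 1)) ≤ row i j

namespace CylindricPartition

variable {r : ℕ} [NeZero r] {c : Fin r → ℕ}

/-- The size `|Λ|`: the sum of all the parts of all the partitions in `Λ`. -/
def size (Λ : CylindricPartition c) : ℕ :=
  ∑ i, (Λ.row i).sum fun _ part => part

/-- The largest part `max(Λ)` (zero for the empty cylindric partition). -/
def maxPart (Λ : CylindricPartition c) : ℕ :=
  Finset.univ.sup fun i => (Λ.row i).support.sup (Λ.row i)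

end CylindricPartition

/-- The generating function `F_c(z, q) = ∑_Λ z ^ max(Λ) * q ^ |Λ|`, the sum running over all
cylindric partitions `Λ` with profile `c`. -/
noncomputable def cylindricGenFun {r : ℕ} [NeZero r] (c : Fin r → ℕ) (z q : ℂ) : ℂ :=
  ∑' Λ : CylindricPartition c, z ^ Λ.maxPart * q ^ Λ.size

/-- The finite `q`-Pochhammer symbol `(a; q)_n = ∏_{k=1}^{n} (1 - a q^{k-1})`. -/
noncomputable def qPochhammer (a q : ℂ) (n : ℕ) : ℂ :=
  ∏ k ∈ Finset.range n, (1 - a * q ^ k)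

/-- The infinite `q`-Pochhammer symbol `(a; q)_∞ = lim_{n → ∞} (a; q)_n`. -/
noncomputable def qPochhammerInf (a q : ℂ) : ℂ :=
  limUnder atTop (qPochhammer a q)

/-- The term `2 q^{n(n+1)} (-q²; q²)_{n-1} / ((q²; q²)_n (-q; q²)_n)`, used for `n ≥ 1` only. -/
noncomputable def levelTwoTerm (q : ℂ) (n : ℕ) : ℂ :=
  2 * q ^ (n * (n + 1)) * qPochhammer (-q ^ 2) (q ^ 2) (n - 1) /
    (qPochhammer (q ^ 2) (q ^ 2) n * qPochhammer (-q) (q ^ 2) n)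

/-! Let A_N, B_N, C_N be the sums of q^|Λ| over cylindric partitions with all parts at most N and
profiles (1,0,1,0), (1,1,0,0), (2,0,0,0). Stripping leading parts equal to N from some rows changes
the profile in a controlled way, so inclusion-exclusion over the rows that can hold the maximum,
together with rotation of rows, gives a closed linear system for these sequences
(`leadingGenFun_2000`, `leadingGenFun_1100`, `leadingGenFun_1010`).

The system is solved by power series in t (`eq_coeff_of_recurrence`): ∑ A_N t^N is (∑ q^(k²) α_k
t^k) / (t;q)_∞, where α_k satisfies a three-term recurrence. That recurrence is a q²-difference
equation for ∑ α_k t^k, whose solution is (-qt;q²)_∞ / ((qt;q²)_∞ (t;q²)_∞). The q-binomial theorem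
and Euler's expansion then turn α_k into a convolution (`mk_levelTwoCoeff_fst`).

As N → ∞, A_N tends to F_(1,0,1,0)(1,q) on one side and to ∑ q^(k²) α_k / (q;q)_∞ on the other.
Writing k = n + m, the sum over m is Euler's (-q^(2n+1);q²)_∞ = (-q;q²)_∞ / (-q;q²)_n, and the
remaining sum over n is the stated series. -/

/-! ### Convergence, non-vanishing and bounds for q-Pochhammer symbols. -/

section QPochhammer

@[simp]
theorem qPochhammer_zero (a q : ℂ) : qPochhammer a q 0 = 1 := by
  simp [qPochhammer]

theorem qPochhammer_succ (a q : ℂ) (n : ℕ) :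
    qPochhammer a q (n + 1) = qPochhammer a q n * (1 - a * q ^ n) :=
  Finset.prod_range_succ _ _

theorem qPochhammer_succ' (a q : ℂ) (n : ℕ) :
    qPochhammer a q (n + 1) = (1 - a) * qPochhammer (a * q) q n := by
  simp only [qPochhammer, Finset.prod_range_succ', pow_zero, mul_one]
  rw [mul_comm]
  congr 1
  refine Finset.prod_congr rfl fun k _ => ?_
  ring

theorem qPochhammer_ne_zero {a q : ℂ} (h : ∀ k, 1 - a * q ^ k ≠ 0) (n : ℕ) :
    qPochhammer a q n ≠ 0 :=
  Finset.prod_ne_zero_iff.mpr fun k _ => h k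

theorem summable_norm_mul_pow (a : ℂ) {q : ℂ} (hq : ‖q‖ < 1) :
    Summable fun k : ℕ => ‖-(a * q ^ k)‖ := by
  simp only [norm_neg, norm_mul, norm_pow]
  exact (summable_geometric_of_lt_one (norm_nonneg q) hq).mul_left _

theorem tendsto_qPochhammer_tprod (a : ℂ) {q : ℂ} (hq : ‖q‖ < 1) :
    Tendsto (qPochhammer a q) atTop (𝓝 (∏' k : ℕ, (1 + -(a * q ^ k)))) := by
  have h := (multipliable_one_add_of_summable (summable_norm_mul_pow a hq)).tendsto_prod_tprod_nat
  refine h.congr fun n => ?_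
  simp [qPochhammer, sub_eq_add_neg]

theorem tendsto_qPochhammer (a : ℂ) {q : ℂ} (hq : ‖q‖ < 1) :
    Tendsto (qPochhammer a q) atTop (𝓝 (qPochhammerInf a q)) :=
  tendsto_nhds_limUnder ⟨_, tendsto_qPochhammer_tprod a hq⟩

theorem qPochhammerInf_ne_zero {a q : ℂ} (hq : ‖q‖ < 1) (h : ∀ k, 1 - a * q ^ k ≠ 0) :
    qPochhammerInf a q ≠ 0 := by
  rw [tendsto_nhds_unique (tendsto_qPochhammer a hq) (tendsto_qPochhammer_tprod a hq)]
  exact tprod_one_add_ne_zero_of_summable (fun k => by simpa [sub_eq_add_neg] using h k)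
    (summable_norm_mul_pow a hq)

theorem exists_norm_qPochhammer_le (a : ℂ) {q : ℂ} (hq : ‖q‖ < 1) :
    ∃ K, ∀ n, ‖qPochhammer a q n‖ ≤ K := by
  obtain ⟨K, hK⟩ := (tendsto_qPochhammer a hq).norm.bddAbove_range
  exact ⟨K, fun n => hK ⟨n, rfl⟩⟩

theorem exists_norm_inv_qPochhammer_le {a q : ℂ} (hq : ‖q‖ < 1) (h : ∀ k, 1 - a * q ^ k ≠ 0) :
    ∃ K, ∀ n, ‖(qPochhammer a q n)⁻¹‖ ≤ K := by
  obtain ⟨K, hK⟩ :=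
    ((tendsto_qPochhammer a hq).inv₀ (qPochhammerInf_ne_zero hq h)).norm.bddAbove_range
  exact ⟨K, fun n => hK ⟨n, rfl⟩⟩

theorem one_sub_mul_pow_ne_zero {a q : ℂ} (ha : ‖a‖ < 1) (hq : ‖q‖ < 1) (k : ℕ) :
    1 - a * q ^ k ≠ 0 := by
  intro h
  have h1 : ‖a * q ^ k‖ = 1 := by rw [← sub_eq_zero.mp h, norm_one]
  have h2 : ‖q‖ ^ k ≤ 1 := pow_le_one₀ (norm_nonneg q) hq.le
  rw [norm_mul, norm_pow] at h1
  nlinarith [norm_nonneg a, norm_nonneg q]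

theorem norm_sq_lt_one {q : ℂ} (hq : ‖q‖ < 1) : ‖q ^ 2‖ < 1 := by
  rw [norm_pow]
  exact pow_lt_one₀ (norm_nonneg q) hq two_ne_zero

theorem one_sub_pow_succ_ne_zero {q : ℂ} (hq : ‖q‖ < 1) (k : ℕ) : 1 - q ^ (k + 1) ≠ 0 := by
  simpa [pow_succ'] using one_sub_mul_pow_ne_zero hq hq k

theorem prod_inv_one_sub_pow_bounded {x : ℝ} (hx0 : 0 ≤ x) (hx : x < 1) :
    ∃ K : ℝ, ∀ N, ∏ k ∈ Finset.range N, (1 - x ^ (k + 1))⁻¹ ≤ K := by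
  have hxn : ‖(x : ℂ)‖ < 1 := by simpa [abs_of_nonneg hx0] using hx
  obtain ⟨K, hK⟩ := exists_norm_inv_qPochhammer_le hxn (one_sub_mul_pow_ne_zero hxn hxn)
  refine ⟨K, fun N => le_trans (le_of_eq ?_) (hK N)⟩
  rw [norm_inv, qPochhammer, norm_prod, Finset.prod_inv_distrib]
  congr 1
  refine Finset.prod_congr rfl fun k _ => ?_
  have h : 0 ≤ 1 - x ^ (k + 1) := sub_nonneg.mpr (pow_le_one₀ hx0 hx.le)
  rw [← pow_succ', ← Complex.ofReal_pow, ← Complex.ofReal_one, ← Complex.ofReal_sub,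
    Complex.norm_real, Real.norm_of_nonneg h]

end QPochhammer

/-! ### Absolute convergence of the generating function. -/

section Summability

theorem Finsupp.sum_eq_sum_range {f : ℕ →₀ ℕ} {M : ℕ} (hf : ∀ j, M ≤ j → f j = 0) :
    (f.sum fun _ part => part) = ∑ j ∈ Finset.range M, f j := by
  rw [Finsupp.sum]
  refine Finset.sum_subset (fun j hj => ?_) fun j _ hj => by simpa using hj
  rw [Finset.mem_range]
  by_contra h
  exact (Finsupp.mem_support_iff.mp hj) (hf j (not_lt.mp h))

theorem Finsupp.exists_forall_ge_eq_zero (f : ℕ →₀ ℕ) : ∃ M, ∀ j, M ≤ j → f j = 0 := by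
  obtain ⟨M, hM⟩ := f.support.exists_nat_subset_range
  refine ⟨M, fun j hj => ?_⟩
  by_contra h
  have := Finset.mem_range.mp (hM (Finsupp.mem_support_iff.mpr h))
  omega

/-- Since indices start at 0, `f N = 0` means at most `N` nonzero parts. In the induction step the
smallest of the `N + 1` parts is subtracted from all of them: its value contributes a geometric
series in x^(N+1), and what remains has at most `N` parts. -/
theorem sum_pow_size_le_prod {x : ℝ} (hx0 : 0 ≤ x) (hx : x < 1) (N : ℕ) :
    ∀ s : Finset (ℕ →₀ ℕ), (∀ f ∈ s, Antitone f ∧ f N = 0) →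
      ∑ f ∈ s, x ^ (f.sum fun _ part => part) ≤ ∏ k ∈ Finset.range N, (1 - x ^ (k + 1))⁻¹ := by
  induction N with
  | zero =>
    intro s hs
    have hsub : s ⊆ {0} := by
      intro f hf
      rw [Finset.mem_singleton]
      ext j
      have := (hs f hf).1 (Nat.zero_le j)
      have := (hs f hf).2
      simp only [Finsupp.coe_zero, Pi.zero_apply]
      omega
    refine (Finset.sum_le_sum_of_subset_of_nonneg hsub fun _ _ _ => by positivity).trans ?_
    simp
  | succ N ih =>
    intro s hs
    let g : (ℕ →₀ ℕ) → (ℕ →₀ ℕ) := fun f => f.mapRange (fun m => m - f N) (Nat.zero_sub _)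
    have hg : ∀ f j, g f j = f j - f N := fun f j => by simp [g]
    have hsize : ∀ f ∈ s, (f.sum fun _ part => part) =
        (N + 1) * f N + (g f).sum fun _ part => part := by
      intro f hf
      obtain ⟨hanti, hz⟩ := hs f hf
      have hz' : ∀ j, N + 1 ≤ j → f j = 0 := fun j hj => by
        have := hanti hj
        omega
      rw [Finsupp.sum_eq_sum_range hz',
        Finsupp.sum_eq_sum_range (f := g f) (M := N + 1) fun j hj => by rw [hg, hz' j hj]; simp]
      have : ∀ j ∈ Finset.range (N + 1), f j = f N + g f j := by
        intro j hj
        have := hanti (Nat.lt_succ_iff.mp (Finset.mem_range.mp hj))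
        rw [hg]
        omega
      rw [Finset.sum_congr rfl this, Finset.sum_add_distrib]
      simp
    have hinj : Set.InjOn (fun f : ℕ →₀ ℕ => (f N, g f)) s := by
      intro f hf f' hf' h
      simp only [Prod.mk.injEq] at h
      ext j
      have h1 := DFunLike.congr_fun h.2 j
      rw [hg, hg] at h1
      by_cases hj : j ≤ N
      · have := (hs f hf).1 hj
        have := (hs f' hf').1 hj
        omega
      · have hj' : N + 1 ≤ j := by omega
        have := (hs f hf).1 hj'
        have := (hs f' hf').1 hj'
        have := (hs f hf).2
        have := (hs f' hf').2
        omega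
    have hy0 : 0 ≤ x ^ (N + 1) := pow_nonneg hx0 _
    have hy1 : x ^ (N + 1) < 1 := pow_lt_one₀ hx0 hx (Nat.succ_ne_zero N)
    have hgeom : ∑ k ∈ s.image (fun f => f N), (x ^ (N + 1)) ^ k ≤ (1 - x ^ (N + 1))⁻¹ := by
      rw [← tsum_geometric_of_lt_one hy0 hy1]
      exact (summable_geometric_of_lt_one hy0 hy1).sum_le_tsum _ fun _ _ => by positivity
    have hrec := ih (s.image g) (by
      intro f' hf'
      obtain ⟨f, hf, rfl⟩ := Finset.mem_image.mp hf'
      refine ⟨fun i j hij => ?_, by simp [hg]⟩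
      rw [hg, hg]
      exact Nat.sub_le_sub_right ((hs f hf).1 hij) _)
    calc ∑ f ∈ s, x ^ (f.sum fun _ part => part)
        = ∑ f ∈ s, (x ^ (N + 1)) ^ (f N) * x ^ ((g f).sum fun _ part => part) := by
          refine Finset.sum_congr rfl fun f hf => ?_
          rw [hsize f hf, pow_add, pow_mul]
      _ = ∑ p ∈ s.image (fun f : ℕ →₀ ℕ => (f N, g f)),
            (x ^ (N + 1)) ^ p.1 * x ^ (p.2.sum fun _ part => part) :=
          (Finset.sum_image (f := fun p : ℕ × (ℕ →₀ ℕ) =>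
            (x ^ (N + 1)) ^ p.1 * x ^ (p.2.sum fun _ part => part)) hinj).symm
      _ ≤ ∑ p ∈ (s.image fun f => f N) ×ˢ (s.image g),
            (x ^ (N + 1)) ^ p.1 * x ^ (p.2.sum fun _ part => part) := by
          refine Finset.sum_le_sum_of_subset_of_nonneg ?_ fun _ _ _ => by positivity
          intro p hp
          obtain ⟨f, hf, rfl⟩ := Finset.mem_image.mp hp
          exact Finset.mem_product.mpr
            ⟨Finset.mem_image_of_mem _ hf, Finset.mem_image_of_mem _ hf⟩
      _ = (∑ k ∈ s.image (fun f => f N), (x ^ (N + 1)) ^ k) *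
            ∑ f ∈ s.image g, x ^ (f.sum fun _ part => part) := by
          rw [Finset.sum_mul_sum, Finset.sum_product]
      _ ≤ (1 - x ^ (N + 1))⁻¹ * ∏ k ∈ Finset.range N, (1 - x ^ (k + 1))⁻¹ :=
          mul_le_mul hgeom hrec (Finset.sum_nonneg fun _ _ => by positivity)
            (inv_nonneg.mpr (sub_nonneg.mpr hy1.le))
      _ = ∏ k ∈ Finset.range (N + 1), (1 - x ^ (k + 1))⁻¹ := by
          rw [Finset.prod_range_succ, mul_comm]

theorem sum_pow_size_bounded {x : ℝ} (hx0 : 0 ≤ x) (hx : x < 1) :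
    ∃ K : ℝ, 0 ≤ K ∧ ∀ s : Finset (ℕ →₀ ℕ), (∀ f ∈ s, Antitone f) →
      ∑ f ∈ s, x ^ (f.sum fun _ part => part) ≤ K := by
  obtain ⟨K, hK⟩ := prod_inv_one_sub_pow_bounded hx0 hx
  refine ⟨K, zero_le_one.trans (by simpa using hK 0), fun s hs => ?_⟩
  choose M hM using Finsupp.exists_forall_ge_eq_zero
  refine (sum_pow_size_le_prod hx0 hx (s.sup M) s fun f hf => ⟨hs f hf, ?_⟩).trans (hK _)
  exact hM f _ (Finset.le_sup hf)

namespace CylindricPartition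

variable {r : ℕ} [NeZero r] {c : Fin r → ℕ}

/-- Forgetting the inequalities between rows embeds cylindric partitions into `r`-tuples of ordinary
partitions, where the sum factorizes. -/
theorem summable_pow_size_real {x : ℝ} (hx0 : 0 ≤ x) (hx : x < 1) :
    Summable fun Λ : CylindricPartition c => x ^ Λ.size := by
  classical
  obtain ⟨K, hK0, hK⟩ := sum_pow_size_bounded hx0 hx
  refine summable_of_sum_le (c := K ^ r) (fun _ => by positivity) fun s => ?_
  let t : Finset (ℕ →₀ ℕ) := s.biUnion fun Λ => Finset.univ.image Λ.row
  have ht : ∀ f ∈ t, Antitone f := by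
    intro f hf
    obtain ⟨Λ, _, hΛ⟩ := Finset.mem_biUnion.mp hf
    obtain ⟨i, _, rfl⟩ := Finset.mem_image.mp hΛ
    exact Λ.antitone_row i
  have hinj : Set.InjOn (fun Λ : CylindricPartition c => Λ.row) s :=
    fun Λ _ Λ' _ h => CylindricPartition.ext h
  calc ∑ Λ ∈ s, x ^ Λ.size
      = ∑ Λ ∈ s, ∏ i, x ^ ((Λ.row i).sum fun _ part => part) :=
        Finset.sum_congr rfl fun Λ _ => by rw [size, Finset.prod_pow_eq_pow_sum]
    _ = ∑ p ∈ s.image fun Λ : CylindricPartition c => Λ.row,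
          ∏ i, x ^ ((p i).sum fun _ part => part) :=
        (Finset.sum_image (f := fun p : Fin r → ℕ →₀ ℕ =>
          ∏ i, x ^ ((p i).sum fun _ part => part)) hinj).symm
    _ ≤ ∑ p ∈ Fintype.piFinset fun _ : Fin r => t, ∏ i, x ^ ((p i).sum fun _ part => part) := by
        refine Finset.sum_le_sum_of_subset_of_nonneg ?_ fun _ _ _ =>
          Finset.prod_nonneg fun _ _ => by positivity
        intro p hp
        obtain ⟨Λ, hΛ, rfl⟩ := Finset.mem_image.mp hp
        exact Fintype.mem_piFinset.mpr fun i => Finset.mem_biUnion.mpr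
          ⟨Λ, hΛ, Finset.mem_image_of_mem _ (Finset.mem_univ i)⟩
    _ = ∏ _i : Fin r, ∑ f ∈ t, x ^ (f.sum fun _ part => part) :=
        (Finset.prod_univ_sum (fun _ : Fin r => t)
          fun _ f => x ^ (f.sum fun _ part => part)).symm
    _ ≤ K ^ r := by
        rw [Finset.prod_const, Finset.card_univ, Fintype.card_fin]
        exact pow_le_pow_left₀ (Finset.sum_nonneg fun _ _ => by positivity) (hK t ht) r

theorem summable_norm_pow_size {q : ℂ} (hq : ‖q‖ < 1) :
    Summable fun Λ : CylindricPartition c => ‖q ^ Λ.size‖ := by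
  simpa only [norm_pow] using summable_pow_size_real (norm_nonneg q) hq

end CylindricPartition

end Summability

namespace CylindricPartition

/-! ### Stripping leading parts and the resulting change of profile. -/

section Prepend

variable {r : ℕ} [NeZero r] {c c' e : Fin r → ℕ} {N : ℕ}

/-- The parts are at most `N`, and the `i`-th row begins with `e i` parts equal to `N`. -/
def LeadsWith (N : ℕ) (e : Fin r → ℕ) (Λ : CylindricPartition c) : Prop :=
  (∀ i, Λ.row i 0 ≤ N) ∧ ∀ i, ∀ j < e i, Λ.row i j = N

theorem row_le (Λ : CylindricPartition c) (h : ∀ i, Λ.row i 0 ≤ N) (i : Fin r) (j : ℕ) :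
    Λ.row i j ≤ N :=
  (Λ.antitone_row i (Nat.zero_le j)).trans (h i)

/-- Remove the first `e i` parts of the `i`-th row. -/
noncomputable def drop (hc : ∀ i, c' (i + 1) + e (i + 1) = c (i + 1) + e i)
    (Λ : CylindricPartition c) : CylindricPartition c' where
  row i := (Λ.row i).comapDomain (· + e i) (add_left_injective _).injOn
  antitone_row i j k hjk := by
    simp only [Finsupp.comapDomain_apply]
    exact Λ.antitone_row i (by omega)
  le_row i j := by
    simp only [Finsupp.comapDomain_apply]
    have h := Λ.le_row i (j + e i)
    rwa [show j + e i + c (i + 1) = j + c' (i + 1) + e (i + 1) by have := hc i; omega] at h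

/-- Put `e i` parts equal to `N` in front of the `i`-th row. -/
noncomputable def prepend (hc : ∀ i, c' (i + 1) + e (i + 1) = c (i + 1) + e i) (N : ℕ)
    (Λ : CylindricPartition c') (hΛ : ∀ i, Λ.row i 0 ≤ N) : CylindricPartition c where
  row i := Finsupp.ofSupportFinite (fun j => if j < e i then N else Λ.row i (j - e i)) (by
    obtain ⟨M, hM⟩ := Finsupp.exists_forall_ge_eq_zero (Λ.row i)
    refine (Set.finite_lt_nat (M + e i)).subset fun j hj => ?_
    by_contra h
    have hle : M + e i ≤ j := not_lt.mp h
    refine hj ((if_neg (by omega)).trans (hM _ (by omega))))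
  antitone_row i j k hjk := by
    simp only [Finsupp.ofSupportFinite_coe]
    split_ifs with h1 h2
    · exact le_rfl
    · omega
    · exact Λ.row_le hΛ _ _
    · exact Λ.antitone_row i (by omega)
  le_row i j := by
    simp only [Finsupp.ofSupportFinite_coe]
    have := hc i
    split_ifs with h1 h2 h3
    · exact le_rfl
    · omega
    · exact Λ.row_le hΛ _ _
    · have h := Λ.le_row i (j - e i)
      rwa [show j - e i + c' (i + 1) = j + c (i + 1) - e (i + 1) by omega] at h

theorem drop_row_apply (hc : ∀ i, c' (i + 1) + e (i + 1) = c (i + 1) + e i)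
    (Λ : CylindricPartition c) (i : Fin r) (j : ℕ) : (drop hc Λ).row i j = Λ.row i (j + e i) :=
  rfl

theorem prepend_row_apply (hc : ∀ i, c' (i + 1) + e (i + 1) = c (i + 1) + e i)
    (Λ : CylindricPartition c') (hΛ : ∀ i, Λ.row i 0 ≤ N) (i : Fin r) (j : ℕ) :
    (prepend hc N Λ hΛ).row i j = if j < e i then N else Λ.row i (j - e i) :=
  rfl

/-- Removing the leading parts is a bijection. -/
noncomputable def dropEquiv (hc : ∀ i, c' (i + 1) + e (i + 1) = c (i + 1) + e i) (N : ℕ) :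
    {Λ : CylindricPartition c // LeadsWith N e Λ} ≃
      {Λ : CylindricPartition c' // LeadsWith N 0 Λ} where
  toFun Λ := ⟨drop hc Λ.1, fun i => by
    rw [drop_row_apply]
    exact Λ.1.row_le Λ.2.1 _ _, fun i j hj => absurd hj (Nat.not_lt_zero j)⟩
  invFun Λ := ⟨prepend hc N Λ.1 Λ.2.1, fun i => by
    rw [prepend_row_apply]
    split_ifs
    · exact le_rfl
    · exact Λ.1.row_le Λ.2.1 _ _, fun i j hj => by rw [prepend_row_apply, if_pos hj]⟩
  left_inv Λ := by
    apply Subtype.ext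
    ext i j
    simp only [prepend_row_apply, drop_row_apply]
    split_ifs with h
    · exact (Λ.2.2 i j h).symm
    · rw [Nat.sub_add_cancel (not_lt.mp h)]
  right_inv Λ := by
    apply Subtype.ext
    ext i j
    simp [prepend_row_apply, drop_row_apply]

theorem size_drop (hc : ∀ i, c' (i + 1) + e (i + 1) = c (i + 1) + e i)
    (Λ : CylindricPartition c) (hΛ : LeadsWith N e Λ) :
    Λ.size = N * (∑ i, e i) + (drop hc Λ).size := by
  rw [size, size, Finset.mul_sum, ← Finset.sum_add_distrib]
  refine Finset.sum_congr rfl fun i _ => ?_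
  obtain ⟨M, hM⟩ := Finsupp.exists_forall_ge_eq_zero (Λ.row i)
  rw [Finsupp.sum_eq_sum_range (M := e i + M) fun j hj => hM j (by omega),
    Finsupp.sum_eq_sum_range (M := M) fun j hj => by
      rw [drop_row_apply]
      exact hM _ (by omega), Finset.sum_range_add]
  congr 1
  · rw [Finset.sum_congr rfl fun j hj => hΛ.2 i j (Finset.mem_range.mp hj)]
    simp [mul_comm]
  · exact Finset.sum_congr rfl fun j _ => by rw [drop_row_apply, add_comm]

end Prepend

/-! ### Generating functions with bounded parts, and inclusion-exclusion. -/

section Truncated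

variable {r : ℕ} [NeZero r]

open Classical in
/-- The sum of `q ^ |Λ|` over the cylindric partitions with parts at most `N` whose `i`-th row
begins with `e i` parts equal to `N`. -/
noncomputable def leadingGenFun (c e : Fin r → ℕ) (q : ℂ) (N : ℕ) : ℂ :=
  ∑' Λ : CylindricPartition c, if LeadsWith N e Λ then q ^ Λ.size else 0

theorem leadingGenFun_eq_tsum_subtype (c e : Fin r → ℕ) (q : ℂ) (N : ℕ) :
    leadingGenFun c e q N = ∑' Λ : {Λ : CylindricPartition c // LeadsWith N e Λ}, q ^ Λ.1.size := by
  classical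
  rw [leadingGenFun]
  refine Eq.trans ?_
    (tsum_subtype {Λ : CylindricPartition c | LeadsWith N e Λ} fun Λ => q ^ Λ.size).symm
  refine tsum_congr fun Λ => ?_
  simp [Set.indicator_apply]

theorem leadingGenFun_eq_mul {c c' e : Fin r → ℕ}
    (hc : ∀ i, c' (i + 1) + e (i + 1) = c (i + 1) + e i) (q : ℂ) (N : ℕ) :
    leadingGenFun c e q N = q ^ (N * ∑ i, e i) * leadingGenFun c' 0 q N := by
  rw [leadingGenFun_eq_tsum_subtype, leadingGenFun_eq_tsum_subtype, ← tsum_mul_left,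
    ← (dropEquiv hc N).tsum_eq]
  refine tsum_congr fun Λ => ?_
  rw [size_drop hc Λ.1 Λ.2, pow_add]
  rfl

theorem leadsWith_zero_iff {c : Fin r → ℕ} {N : ℕ} {Λ : CylindricPartition c} :
    LeadsWith N 0 Λ ↔ ∀ i, Λ.row i 0 ≤ N :=
  ⟨fun h => h.1, fun h => ⟨h, fun _ j hj => absurd hj (Nat.not_lt_zero j)⟩⟩

open Classical in
theorem summable_leadingGenFun (c e : Fin r → ℕ) {q : ℂ} (hq : ‖q‖ < 1) (N : ℕ) :
    Summable fun Λ : CylindricPartition c => if LeadsWith N e Λ then q ^ Λ.size else 0 := by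
  refine Summable.of_norm_bounded (summable_norm_pow_size hq) fun Λ => ?_
  split_ifs
  · exact le_rfl
  · simp

theorem leadingGenFun_zero (c : Fin r → ℕ) (q : ℂ) : leadingGenFun c 0 q 0 = 1 := by
  classical
  let Λ₀ : CylindricPartition c := ⟨0, fun _ _ _ _ => le_rfl, fun _ _ => le_rfl⟩
  rw [leadingGenFun, tsum_eq_single Λ₀]
  · rw [if_pos (leadsWith_zero_iff.mpr fun i => le_rfl)]
    simp [size, Λ₀]
  · intro Λ hΛ
    rw [if_neg]
    intro h
    apply hΛ
    ext i j
    exact Nat.le_zero.mp (Λ.row_le h.1 i j)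

theorem tendsto_leadingGenFun (c : Fin r → ℕ) {q : ℂ} (hq : ‖q‖ < 1) :
    Tendsto (leadingGenFun c 0 q) atTop (𝓝 (∑' Λ : CylindricPartition c, q ^ Λ.size)) := by
  classical
  refine tendsto_tsum_of_dominated_convergence (summable_norm_pow_size hq) (fun Λ => ?_)
    (Eventually.of_forall fun N Λ => ?_)
  · refine tendsto_const_nhds.congr' ?_
    filter_upwards [eventually_ge_atTop (Finset.univ.sup fun i => Λ.row i 0)] with N hN
    rw [if_pos (leadsWith_zero_iff.mpr fun i => ?_)]
    exact (Finset.le_sup (f := fun i => Λ.row i 0) (Finset.mem_univ i)).trans hN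
  · split_ifs
    · exact le_rfl
    · simp

/-- If the largest part always occurs at the beginning of row `i` or row `k`, then the
inclusion-exclusion principle applies. -/
theorem leadingGenFun_succ_of_two {c e₁ e₂ e₁₂ : Fin r → ℕ} {i k : Fin r}
    (hik : ∀ Λ : CylindricPartition c, ∀ N, Λ.row i 0 ≤ N → Λ.row k 0 ≤ N → ∀ l, Λ.row l 0 ≤ N)
    (h₁ : ∀ (Λ : CylindricPartition c) N,
      LeadsWith N e₁ Λ ↔ LeadsWith N 0 Λ ∧ Λ.row i 0 = N)
    (h₂ : ∀ (Λ : CylindricPartition c) N,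
      LeadsWith N e₂ Λ ↔ LeadsWith N 0 Λ ∧ Λ.row k 0 = N)
    (h₁₂ : ∀ (Λ : CylindricPartition c) N,
      LeadsWith N e₁₂ Λ ↔ LeadsWith N 0 Λ ∧ Λ.row i 0 = N ∧ Λ.row k 0 = N)
    {q : ℂ} (hq : ‖q‖ < 1) (N : ℕ) :
    leadingGenFun c 0 q (N + 1) + leadingGenFun c e₁₂ q (N + 1) = leadingGenFun c 0 q N +
      leadingGenFun c e₁ q (N + 1) + leadingGenFun c e₂ q (N + 1) := by
  classical
  simp only [leadingGenFun]
  rw [← (summable_leadingGenFun c 0 hq _).tsum_add (summable_leadingGenFun c e₁₂ hq _),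
    ← (summable_leadingGenFun c 0 hq _).tsum_add (summable_leadingGenFun c e₁ hq _),
    ← ((summable_leadingGenFun c 0 hq _).add (summable_leadingGenFun c e₁ hq _)).tsum_add
      (summable_leadingGenFun c e₂ hq _)]
  refine tsum_congr fun Λ => ?_
  simp only [h₁, h₂, h₁₂, leadsWith_zero_iff]
  by_cases hN : ∀ l, Λ.row l 0 ≤ N
  · have hi := hN i
    have hk := hN k
    have hN' : ∀ l, Λ.row l 0 ≤ N + 1 := fun l => (hN l).trans N.le_succ
    rw [if_pos hN', if_pos hN, if_neg (by omega), if_neg (by omega), if_neg (by omega)]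
    ring
  · by_cases hN' : ∀ l, Λ.row l 0 ≤ N + 1
    · have hi := hN' i
      have hk := hN' k
      have hor : Λ.row i 0 = N + 1 ∨ Λ.row k 0 = N + 1 := by
        by_contra h
        exact hN (hik Λ N (by omega) (by omega))
      simp only [hN', hN, if_false, implies_true, true_and, if_true]
      by_cases h1 : Λ.row i 0 = N + 1 <;> by_cases h2 : Λ.row k 0 = N + 1 <;> simp_all
    · simp [hN, hN']

/-- If the largest part always occurs at the beginning of row `i`, then either all parts are
smaller than the given bound, or row `i` begins with it. -/
theorem leadingGenFun_succ_of_one {c e : Fin r → ℕ} {i : Fin r}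
    (hi : ∀ Λ : CylindricPartition c, ∀ l, Λ.row l 0 ≤ Λ.row i 0)
    (he : ∀ (Λ : CylindricPartition c) N, LeadsWith N e Λ ↔ LeadsWith N 0 Λ ∧ Λ.row i 0 = N)
    {q : ℂ} (hq : ‖q‖ < 1) (N : ℕ) :
    leadingGenFun c 0 q (N + 1) = leadingGenFun c 0 q N + leadingGenFun c e q (N + 1) := by
  -- The two rows are taken to coincide, so the intersection term cancels one of the two single-row
  -- terms.
  have h := leadingGenFun_succ_of_two (fun Λ N h _ l => (hi Λ l).trans h) he he
    (e₁₂ := e) (fun Λ N => by rw [he, and_self_iff]) hq N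
  exact add_right_cancel (h.trans rfl)

end Truncated

/-! ### Invariance under cyclic rotation of the profile. -/

section Rotation

variable {r : ℕ} [NeZero r]

/-- Rotate the rows of a cylindric partition by one. -/
def rotate {c c' : Fin r → ℕ} (hc : ∀ i, c' i = c (i + 1)) (Λ : CylindricPartition c) :
    CylindricPartition c' where
  row i := Λ.row (i + 1)
  antitone_row i := Λ.antitone_row (i + 1)
  le_row i j := by
    rw [hc]
    exact Λ.le_row (i + 1) j

/-- Rotate the rows of a cylindric partition by one, in the opposite direction. -/
def rotateBack {c c' : Fin r → ℕ} (hc : ∀ i, c' i = c (i + 1)) (Λ : CylindricPartition c') :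
    CylindricPartition c where
  row i := Λ.row (i - 1)
  antitone_row i := Λ.antitone_row (i - 1)
  le_row i j := by
    have h := Λ.le_row (i - 1) j
    rw [hc, sub_add_cancel] at h
    rwa [add_sub_cancel_right]

/-- Rotation is a bijection. -/
def rotateEquiv {c c' : Fin r → ℕ} (hc : ∀ i, c' i = c (i + 1)) :
    CylindricPartition c ≃ CylindricPartition c' where
  toFun := rotate hc
  invFun := rotateBack hc
  left_inv Λ := by
    ext i j
    simp [rotate, rotateBack]
  right_inv Λ := by
    ext i j
    simp [rotate, rotateBack]

theorem leadingGenFun_rotate {c c' : Fin r → ℕ} (hc : ∀ i, c' i = c (i + 1)) (q : ℂ) (N : ℕ) :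
    leadingGenFun c' 0 q N = leadingGenFun c 0 q N := by
  classical
  rw [leadingGenFun, leadingGenFun, ← (rotateEquiv hc).tsum_eq]
  refine tsum_congr fun Λ => ?_
  have hsize : (rotateEquiv hc Λ).size = Λ.size :=
    Equiv.sum_comp (Equiv.addRight (1 : Fin r)) fun i => (Λ.row i).sum fun _ part => part
  have hlead : LeadsWith N 0 (rotateEquiv hc Λ) ↔ LeadsWith N 0 Λ := by
    rw [leadsWith_zero_iff, leadsWith_zero_iff]
    exact (Equiv.addRight (1 : Fin r)).forall_congr_right (q := fun i => Λ.row i 0 ≤ N)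
  simp only [hsize, hlead]

end Rotation

/-! ### The linear system for the three level-two profiles. -/

section LevelTwo

/-- The zeros in the profile make the first parts weakly decrease from row 0 to row 3, so row 0
holds the maximum. -/
theorem leadingGenFun_2000 {q : ℂ} (hq : ‖q‖ < 1) (N : ℕ) :
    leadingGenFun ![2, 0, 0, 0] 0 q (N + 1) = leadingGenFun ![2, 0, 0, 0] 0 q N +
      q ^ (N + 1) * leadingGenFun ![1, 1, 0, 0] 0 q (N + 1) := by
  rw [leadingGenFun_succ_of_one (e := ![1, 0, 0, 0]) (i := 0) ?_ ?_ hq N,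
    leadingGenFun_eq_mul (c' := ![1, 1, 0, 0]) (e := ![1, 0, 0, 0]) (by decide)]
  · simp [Fin.sum_univ_four]
  · intro Λ l
    have h0 := Λ.le_row 0 0
    have h1 := Λ.le_row 1 0
    have h2 := Λ.le_row 2 0
    simp at h0 h1 h2
    fin_cases l <;> simp <;> omega
  · intro Λ N
    simp [LeadsWith, Fin.forall_fin_succ]

/-- The maximum starts row 0 or row 1. Stripping row 0, row 1, or both yields (0,2,0,0), (1,0,1,0),
(0,1,1,0); the last is a rotation of the original profile, whence the factor on the left. -/
theorem leadingGenFun_1100 {q : ℂ} (hq : ‖q‖ < 1) (N : ℕ) :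
    (1 + q ^ (2 * (N + 1))) * leadingGenFun ![1, 1, 0, 0] 0 q (N + 1) =
      leadingGenFun ![1, 1, 0, 0] 0 q N + q ^ (N + 1) *
        (leadingGenFun ![2, 0, 0, 0] 0 q (N + 1) + leadingGenFun ![1, 0, 1, 0] 0 q (N + 1)) := by
  have h := leadingGenFun_succ_of_two (c := ![1, 1, 0, 0]) (e₁ := ![1, 0, 0, 0])
    (e₂ := ![0, 1, 0, 0]) (e₁₂ := ![1, 1, 0, 0]) (i := 0) (k := 1) ?_ ?_ ?_ ?_ hq N
  · rw [leadingGenFun_eq_mul (c' := ![0, 1, 1, 0]) (e := ![1, 1, 0, 0]) (by decide),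
      leadingGenFun_eq_mul (c' := ![0, 2, 0, 0]) (e := ![1, 0, 0, 0]) (by decide),
      leadingGenFun_eq_mul (c' := ![1, 0, 1, 0]) (e := ![0, 1, 0, 0]) (by decide),
      ← leadingGenFun_rotate (c := ![0, 1, 1, 0]) (c' := ![1, 1, 0, 0]) (by decide),
      ← leadingGenFun_rotate (c := ![0, 2, 0, 0]) (c' := ![2, 0, 0, 0]) (by decide)] at h
    simp only [Fin.sum_univ_four, Matrix.cons_val] at h
    linear_combination h
  · intro Λ N hi hk l
    have h1 := Λ.le_row 1 0
    have h2 := Λ.le_row 2 0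
    simp at h1 h2
    fin_cases l <;> simp <;> omega
  all_goals
    intro Λ N
    simp [LeadsWith, Fin.forall_fin_succ]

/-- The maximum starts row 0 or row 2. Stripping either one gives a rotation of (1,1,0,0), and
stripping both a rotation of (1,0,1,0). -/
theorem leadingGenFun_1010 {q : ℂ} (hq : ‖q‖ < 1) (N : ℕ) :
    (1 + q ^ (2 * (N + 1))) * leadingGenFun ![1, 0, 1, 0] 0 q (N + 1) =
      leadingGenFun ![1, 0, 1, 0] 0 q N +
        2 * q ^ (N + 1) * leadingGenFun ![1, 1, 0, 0] 0 q (N + 1) := by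
  have h := leadingGenFun_succ_of_two (c := ![1, 0, 1, 0]) (e₁ := ![1, 0, 0, 0])
    (e₂ := ![0, 0, 1, 0]) (e₁₂ := ![1, 0, 1, 0]) (i := 0) (k := 2) ?_ ?_ ?_ ?_ hq N
  · rw [leadingGenFun_eq_mul (c' := ![0, 1, 0, 1]) (e := ![1, 0, 1, 0]) (by decide),
      leadingGenFun_eq_mul (c' := ![0, 1, 1, 0]) (e := ![1, 0, 0, 0]) (by decide),
      leadingGenFun_eq_mul (c' := ![1, 0, 0, 1]) (e := ![0, 0, 1, 0]) (by decide),
      ← leadingGenFun_rotate (c := ![0, 1, 0, 1]) (c' := ![1, 0, 1, 0]) (by decide),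
      ← leadingGenFun_rotate (c := ![0, 1, 1, 0]) (c' := ![1, 1, 0, 0]) (by decide),
      leadingGenFun_rotate (c := ![1, 1, 0, 0]) (c' := ![1, 0, 0, 1]) (by decide)] at h
    simp only [Fin.sum_univ_four, Matrix.cons_val] at h
    linear_combination h
  · intro Λ N hi hk l
    have h0 := Λ.le_row 0 0
    have h2 := Λ.le_row 2 0
    simp at h0 h2
    fin_cases l <;> simp <;> omega
  all_goals
    intro Λ N
    simp [LeadsWith, Fin.forall_fin_succ]

end LevelTwo

end CylindricPartition

/-! ### Solving the system with formal power series. -/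

section Recurrences

open PowerSeries

/-- The pair of sequences with `β k = β (k-1) + q ^ k * α k` and
`(1 - q ^ (2 * k)) * α k = α (k-1) + 2 * q ^ k * β (k-1)`, starting from `1`. -/
noncomputable def levelTwoCoeff (q : ℂ) : ℕ → ℂ × ℂ
  | 0 => (1, 1)
  | k + 1 =>
    let a := ((levelTwoCoeff q k).1 + 2 * q ^ (k + 1) * (levelTwoCoeff q k).2) /
      (1 - q ^ (2 * (k + 1)))
    (a, (levelTwoCoeff q k).2 + q ^ (k + 1) * a)

theorem one_sub_pow_two_mul_succ_ne_zero {q : ℂ} (hq : ‖q‖ < 1) (k : ℕ) :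
    1 - q ^ (2 * (k + 1)) ≠ 0 :=
  one_sub_pow_succ_ne_zero hq (2 * k + 1)

theorem levelTwoCoeff_succ_fst {q : ℂ} (hq : ‖q‖ < 1) (k : ℕ) :
    (1 - q ^ (2 * (k + 1))) * (levelTwoCoeff q (k + 1)).1 =
      (levelTwoCoeff q k).1 + 2 * q ^ (k + 1) * (levelTwoCoeff q k).2 :=
  mul_div_cancel₀ _ (one_sub_pow_two_mul_succ_ne_zero hq k)

theorem levelTwoCoeff_succ_snd (q : ℂ) (k : ℕ) :
    (levelTwoCoeff q (k + 1)).2 =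
      (levelTwoCoeff q k).2 + q ^ (k + 1) * (levelTwoCoeff q (k + 1)).1 :=
  rfl

/-- Elimination of the second sequence from two consecutive steps. -/
theorem levelTwoCoeff_recurrence {q : ℂ} (hq : ‖q‖ < 1) (k : ℕ) :
    (1 - q ^ (2 * (k + 2))) * (levelTwoCoeff q (k + 2)).1 =
      (1 + q + q ^ (2 * k + 3)) * (levelTwoCoeff q (k + 1)).1 - q * (levelTwoCoeff q k).1 := by
  have h1 := levelTwoCoeff_succ_fst hq (k + 1)
  have h2 := levelTwoCoeff_succ_fst hq k
  have h3 := levelTwoCoeff_succ_snd q k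
  linear_combination h1 + 2 * q ^ (k + 2) * h3 - q * h2

/-- The generating series of `1 / (q; q)_n`. -/
noncomputable def invQPochhammerSeries (q : ℂ) : ℂ⟦X⟧ :=
  mk fun n => (qPochhammer q q n)⁻¹

/-- This is the functional equation of 1/(t;q)_∞, which Euler's identity expands as this series. -/
theorem rescale_invQPochhammerSeries {q : ℂ} (hq : ‖q‖ < 1) :
    rescale q (invQPochhammerSeries q) = (1 - X) * invQPochhammerSeries q := by
  ext n
  rw [invQPochhammerSeries, rescale_mk, sub_mul, one_mul, map_sub, coeff_mk, coeff_mk]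
  cases n with
  | zero => simp
  | succ n =>
    rw [coeff_succ_X_mul, coeff_mk, qPochhammer_succ, ← pow_succ']
    have h1 := qPochhammer_ne_zero (one_sub_mul_pow_ne_zero hq hq) n
    have h2 := one_sub_pow_succ_ne_zero hq n
    field_simp
    ring

theorem qPochhammer_sq_succ (a q : ℂ) (n : ℕ) :
    qPochhammer a (q ^ 2) (n + 1) = qPochhammer a (q ^ 2) n * (1 - a * q ^ (2 * n)) := by
  rw [qPochhammer_succ, ← pow_mul]

/-- The coefficient `q ^ n (-1; q²)_n / (q²; q²)_n`. -/
noncomputable def qBinomCoeff (q : ℂ) (n : ℕ) : ℂ :=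
  q ^ n * qPochhammer (-1) (q ^ 2) n * (qPochhammer (q ^ 2) (q ^ 2) n)⁻¹

/-- By the q-binomial theorem the series is (-qt;q²)_∞ / (qt;q²)_∞; only its functional equation
under t ↦ q²t is needed. -/
theorem rescale_qBinomCoeff {q : ℂ} (hq : ‖q‖ < 1) :
    (1 + C q * X) * rescale (q ^ 2) (mk (qBinomCoeff q)) =
      (1 - C q * X) * mk (qBinomCoeff q) := by
  ext n
  rw [rescale_mk, sub_mul, add_mul, one_mul, one_mul, map_sub, map_add, mul_assoc, mul_assoc,
    coeff_mk, coeff_mk, coeff_C_mul, coeff_C_mul]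
  cases n with
  | zero => simp
  | succ n =>
    have h1 := qPochhammer_ne_zero
      (one_sub_mul_pow_ne_zero (norm_sq_lt_one hq) (norm_sq_lt_one hq)) n
    have h2 : 1 - q ^ 2 * q ^ (2 * n) ≠ 0 := by
      rw [← pow_add, show 2 + 2 * n = 2 * (n + 1) by ring]
      exact one_sub_pow_two_mul_succ_ne_zero hq n
    rw [coeff_succ_X_mul, coeff_succ_X_mul, coeff_mk, coeff_mk, qBinomCoeff, qBinomCoeff,
      qPochhammer_sq_succ, qPochhammer_sq_succ]
    field_simp
    ring

/-- A power series with `f(t) (1 - t) (1 - q t) = (1 + q t) f(q² t)` is determined by its constant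
coefficient. -/
theorem PowerSeries.eq_of_rescale_eq {q : ℂ} (hq : ‖q‖ < 1) {f g : ℂ⟦X⟧}
    (hf : (1 - X) * (1 - C q * X) * f = (1 + C q * X) * rescale (q ^ 2) f)
    (hg : (1 - X) * (1 - C q * X) * g = (1 + C q * X) * rescale (q ^ 2) g)
    (h0 : coeff 0 f = coeff 0 g) : f = g := by
  have hrec : ∀ {f : ℂ⟦X⟧},
      (1 - X) * (1 - C q * X) * f = (1 + C q * X) * rescale (q ^ 2) f →
      f = rescale (q ^ 2) f + X * (f + C q * f + C q * rescale (q ^ 2) f - X * (C q * f)) := by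
    intro f hf
    linear_combination hf
  have key : ∀ n, ∀ m ≤ n, coeff m f = coeff m g := by
    intro n
    induction n with
    | zero =>
      intro m hm
      rw [Nat.le_zero.mp hm, h0]
    | succ n ih =>
      intro m hm
      rcases Nat.lt_succ_iff_lt_or_eq.mp (Nat.lt_succ_of_le hm) with hm | rfl
      · exact ih m (Nat.lt_succ_iff.mp hm)
      · have h1 := congrArg (coeff (n + 1)) (hrec hf)
        have h2 := congrArg (coeff (n + 1)) (hrec hg)
        have hn := ih n le_rfl
        have hX : coeff n (X * (C q * f)) = coeff n (X * (C q * g)) := by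
          cases n with
          | zero => simp
          | succ n =>
            rw [coeff_succ_X_mul, coeff_succ_X_mul, coeff_C_mul, coeff_C_mul, ih n n.le_succ]
        simp only [map_add, map_sub, coeff_succ_X_mul, coeff_rescale, coeff_C_mul] at h1 h2
        rw [hX, hn, ← pow_mul] at h1
        rw [← pow_mul] at h2
        -- The coefficient of degree n + 1 enters only with the factor 1 - q^(2(n+1)); everything
        -- else has lower degree.
        apply mul_left_cancel₀ (one_sub_pow_two_mul_succ_ne_zero hq n)
        linear_combination h1 - h2
  ext n
  exact key n n le_rfl

/-- Both sides solve the same q²-difference equation with constant term 1: the left by the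
three-term recurrence, the right by multiplying the functional equations of its factors. -/
theorem mk_levelTwoCoeff_fst {q : ℂ} (hq : ‖q‖ < 1) :
    mk (fun k => (levelTwoCoeff q k).1) =
      mk (qBinomCoeff q) * invQPochhammerSeries (q ^ 2) := by
  apply PowerSeries.eq_of_rescale_eq hq
  · ext n
    have hexp : ∀ f : ℂ⟦X⟧, (1 - X) * (1 - C q * X) * f =
        f - X * (f + C q * f - X * (C q * f)) := fun f => by ring
    have hexp' : ∀ f : ℂ⟦X⟧, (1 + C q * X) * f = f + X * (C q * f) := fun f => by ring
    rw [hexp, hexp']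
    simp only [rescale_mk, map_add, map_sub]
    match n with
    | 0 => simp
    | 1 =>
      have h := levelTwoCoeff_succ_fst hq 0
      simp [levelTwoCoeff] at h ⊢
      linear_combination h
    | n + 2 =>
      have h := levelTwoCoeff_recurrence hq n
      simp only [coeff_succ_X_mul, map_add, map_sub, coeff_C_mul, coeff_mk]
      linear_combination h
  · have h1 := rescale_qBinomCoeff hq
    have h2 := rescale_invQPochhammerSeries (norm_sq_lt_one hq)
    rw [map_mul, h2]
    linear_combination (-(1 - X) * invQPochhammerSeries (q ^ 2)) * h1
  · simp [levelTwoCoeff, qBinomCoeff, invQPochhammerSeries, coeff_mul]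

theorem levelTwoCoeff_fst_eq {q : ℂ} (hq : ‖q‖ < 1) (k : ℕ) :
    (levelTwoCoeff q k).1 = ∑ p ∈ Finset.HasAntidiagonal.antidiagonal k,
      qBinomCoeff q p.1 * (qPochhammer (q ^ 2) (q ^ 2) p.2)⁻¹ := by
  have h := congrArg (coeff k) (mk_levelTwoCoeff_fst hq)
  rw [coeff_mk, coeff_mul] at h
  simpa [invQPochhammerSeries] using h

/-- The numerator series of the generating function for the profile `(1, 0, 1, 0)`. -/
noncomputable def numeratorA (q : ℂ) : ℂ⟦X⟧ := mk fun k => q ^ k ^ 2 * (levelTwoCoeff q k).1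

/-- The numerator series of the generating function for the profile `(1, 1, 0, 0)`. -/
noncomputable def numeratorB (q : ℂ) : ℂ⟦X⟧ := mk fun k => q ^ k ^ 2 * (levelTwoCoeff q k).2

theorem numeratorB_eq (q : ℂ) :
    numeratorB q = C q * X * rescale (q ^ 2) (numeratorB q) + rescale q (numeratorA q) := by
  ext n
  rw [numeratorA, numeratorB, rescale_mk, rescale_mk, map_add, mul_assoc, coeff_C_mul]
  cases n with
  | zero => simp [levelTwoCoeff]
  | succ n =>
    rw [coeff_succ_X_mul, coeff_mk, coeff_mk, coeff_mk, levelTwoCoeff_succ_snd]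
    ring

theorem numeratorA_eq {q : ℂ} (hq : ‖q‖ < 1) :
    numeratorA q + (1 - C q * X) * rescale (q ^ 2) (numeratorA q) =
      2 * rescale q (numeratorB q) := by
  ext n
  rw [numeratorA, numeratorB, rescale_mk, rescale_mk, sub_mul, one_mul, map_add, map_sub,
    mul_assoc, coeff_C_mul, ← map_ofNat (C : ℂ →+* ℂ⟦X⟧), coeff_C_mul]
  cases n with
  | zero =>
    simp [levelTwoCoeff]
    norm_num
  | succ n =>
    rw [coeff_succ_X_mul, coeff_mk, coeff_mk, coeff_mk, coeff_mk, levelTwoCoeff_succ_snd]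
    linear_combination q ^ (n + 1) ^ 2 * levelTwoCoeff_succ_fst hq n

variable {q : ℂ} {A B C' : ℕ → ℂ}

/-- The recurrence relations between the truncated generating functions determine them. -/
theorem eq_coeff_of_recurrence (hq : ‖q‖ < 1) (hA0 : A 0 = 1) (hB0 : B 0 = 1) (hC0 : C' 0 = 1)
    (hC : ∀ N, C' (N + 1) = C' N + q ^ (N + 1) * B (N + 1))
    (hB : ∀ N, (1 + q ^ (2 * (N + 1))) * B (N + 1) =
      B N + q ^ (N + 1) * (C' (N + 1) + A (N + 1)))
    (hA : ∀ N, (1 + q ^ (2 * (N + 1))) * A (N + 1) = A N + 2 * q ^ (N + 1) * B (N + 1)) (N : ℕ) :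
    A N = coeff N (numeratorA q * invQPochhammerSeries q) := by
  set P := invQPochhammerSeries q with hP
  have hP1 : rescale q P = (1 - X) * P := rescale_invQPochhammerSeries hq
  have hrr : ∀ f : ℂ⟦X⟧, rescale (q ^ 2) f = rescale q (rescale q f) := fun f => by
    rw [rescale_rescale, sq]
  have hrX : rescale q (1 - X : ℂ⟦X⟧) = 1 - C q * X := by
    rw [map_sub, map_one, rescale_X]
  have hP2 : rescale (q ^ 2) P = (1 - C q * X) * ((1 - X) * P) := by
    rw [hrr, hP1, map_mul, hrX, hP1]
  -- `eA`, `eB`, `eC` are the recurrences `hA`, `hB`, `hC` in generating-function form: the factor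
  -- q^N becomes t ↦ qt, and the shift of N becomes multiplication by t.
  have eA : numeratorA q * P + rescale (q ^ 2) (numeratorA q * P) =
      X * (numeratorA q * P) + C 2 * rescale q (numeratorB q * P) := by
    rw [map_mul, map_mul, hP1, hP2, map_ofNat]
    linear_combination (1 - X) * P * numeratorA_eq hq
  have eB : numeratorB q * P + rescale (q ^ 2) (numeratorB q * P) = X * (numeratorB q * P) +
      rescale q (rescale q (numeratorB q) * P + numeratorA q * P) := by
    rw [map_mul, map_add, map_mul, map_mul, hP1, hP2, ← hrr]
    linear_combination (1 - X) * P * numeratorB_eq q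
  have eC : rescale q (numeratorB q) * P =
      X * (rescale q (numeratorB q) * P) + rescale q (numeratorB q * P) := by
    rw [map_mul, hP1]
    ring
  have key : ∀ N, A N = coeff N (numeratorA q * P) ∧ B N = coeff N (numeratorB q * P) ∧
      C' N = coeff N (rescale q (numeratorB q) * P) := by
    intro N
    induction N with
    | zero =>
      simp [hA0, hB0, hC0, hP, coeff_mul, numeratorA, numeratorB, levelTwoCoeff,
        invQPochhammerSeries]
    | succ N ih =>
      obtain ⟨ihA, ihB, ihC⟩ := ih
      have fA := congrArg (coeff (N + 1)) eA
      have fB := congrArg (coeff (N + 1)) eB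
      have fC := congrArg (coeff (N + 1)) eC
      simp only [map_add, coeff_succ_X_mul, coeff_rescale, coeff_C_mul] at fA fB fC
      rw [← pow_mul, ← ihA] at fA
      rw [← pow_mul, ← ihB] at fB
      rw [← ihC] at fC
      have gA := hA N
      have gB := hB N
      have gC := hC N
      set Q := q ^ (N + 1) with hQ
      have hQ2 : q ^ (2 * (N + 1)) = Q ^ 2 := by rw [hQ, ← pow_mul, mul_comm]
      have hne := one_sub_pow_two_mul_succ_ne_zero hq N
      rw [hQ2] at fA fB gA gB hne
      have dA : A (N + 1) = coeff (N + 1) (numeratorA q * P) := by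
        apply mul_left_cancel₀ hne
        -- The weights 1, 2Q, 2Q² eliminate the unknowns B and C at N + 1, leaving A with the
        -- nonzero factor 1 - Q².
        linear_combination gA - fA + 2 * Q * (gB - fB) + 2 * Q ^ 2 * (gC - fC)
      rw [← dA] at fA fB ⊢
      have dB : B (N + 1) = coeff (N + 1) (numeratorB q * P) := by
        linear_combination gB - fB + Q * (gC - fC)
      refine ⟨rfl, dB, ?_⟩
      linear_combination gC - fC + Q * dB
  exact (key N).1

end Recurrences

/-! ### The limit N → ∞ and the evaluation of the double sum. -/

section Evaluation

variable {q : ℂ}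

theorem one_sub_neg_mul_sq_pow_ne_zero (hq : ‖q‖ < 1) (k : ℕ) : 1 - -q * (q ^ 2) ^ k ≠ 0 :=
  one_sub_mul_pow_ne_zero (by simpa using hq) (norm_sq_lt_one hq) k

theorem one_sub_sq_mul_sq_pow_ne_zero (hq : ‖q‖ < 1) (k : ℕ) : 1 - q ^ 2 * (q ^ 2) ^ k ≠ 0 :=
  one_sub_mul_pow_ne_zero (norm_sq_lt_one hq) (norm_sq_lt_one hq) k

/-- The series `∑ q ^ (m² + 2 n m) / (q²; q²)_m`. -/
noncomputable def eulerSum (q : ℂ) (n : ℕ) : ℂ :=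
  ∑' m : ℕ, q ^ (m ^ 2 + 2 * n * m) * (qPochhammer (q ^ 2) (q ^ 2) m)⁻¹

theorem exists_summable_bound_eulerSum (hq : ‖q‖ < 1) :
    ∃ b : ℕ → ℝ, Summable b ∧
      ∀ n m, ‖q ^ (m ^ 2 + 2 * n * m) * (qPochhammer (q ^ 2) (q ^ 2) m)⁻¹‖ ≤ b m := by
  obtain ⟨K, hK⟩ :=
    exists_norm_inv_qPochhammer_le (norm_sq_lt_one hq) (one_sub_sq_mul_sq_pow_ne_zero hq)
  refine ⟨fun m => ‖q‖ ^ m * K,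
    (summable_geometric_of_lt_one (norm_nonneg q) hq).mul_right K, fun n m => ?_⟩
  rw [norm_mul, norm_pow]
  exact mul_le_mul (pow_le_pow_of_le_one (norm_nonneg q) hq.le (by nlinarith [Nat.zero_le (n * m)]))
    (hK m) (norm_nonneg _) (by positivity)

theorem summable_eulerSum (hq : ‖q‖ < 1) (n : ℕ) :
    Summable fun m : ℕ => q ^ (m ^ 2 + 2 * n * m) * (qPochhammer (q ^ 2) (q ^ 2) m)⁻¹ := by
  obtain ⟨b, hb, h⟩ := exists_summable_bound_eulerSum hq
  exact Summable.of_norm_bounded hb (h n)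

/-- In the difference of the sums for n and n + 1, the factor 1 - q^(2m) kills the term m = 0 and
cancels the last factor of (q²;q²)_m; shifting m gives back the sum for n + 1. -/
theorem eulerSum_succ (hq : ‖q‖ < 1) (n : ℕ) :
    eulerSum q n = (1 - -q * (q ^ 2) ^ n) * eulerSum q (n + 1) := by
  have hsub := (summable_eulerSum hq n).sub (summable_eulerSum hq (n + 1))
  have h : eulerSum q n - eulerSum q (n + 1) = q ^ (2 * n + 1) * eulerSum q (n + 1) := by
    rw [eulerSum, eulerSum, ← (summable_eulerSum hq n).tsum_sub (summable_eulerSum hq (n + 1)),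
      hsub.tsum_eq_zero_add, ← tsum_mul_left]
    simp only [zero_pow two_ne_zero, mul_zero, add_zero, sub_self, zero_add]
    refine tsum_congr fun m => ?_
    have h1 := qPochhammer_ne_zero (one_sub_sq_mul_sq_pow_ne_zero hq) m
    have h2 := one_sub_sq_mul_sq_pow_ne_zero hq m
    rw [qPochhammer_succ]
    field_simp
    ring
  linear_combination h

theorem tendsto_eulerSum (hq : ‖q‖ < 1) : Tendsto (eulerSum q) atTop (𝓝 1) := by
  obtain ⟨b, hb, h⟩ := exists_summable_bound_eulerSum hq
  have hlim : ∀ m : ℕ, Tendsto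
      (fun n : ℕ => q ^ (m ^ 2 + 2 * n * m) * (qPochhammer (q ^ 2) (q ^ 2) m)⁻¹) atTop
      (𝓝 (if m = 0 then 1 else 0)) := by
    intro m
    cases m with
    | zero => simp
    | succ m =>
      rw [if_neg m.succ_ne_zero]
      have h0 : Tendsto (fun n : ℕ => q ^ n) atTop (𝓝 0) :=
        tendsto_pow_atTop_nhds_zero_of_norm_lt_one hq
      have h1 : Tendsto (fun n : ℕ => (m + 1) ^ 2 + 2 * n * (m + 1)) atTop atTop :=
        tendsto_atTop_mono (fun n => by simp only [id]; nlinarith [Nat.zero_le (n * m)]) tendsto_id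
      simpa using (h0.comp h1).mul_const (qPochhammer (q ^ 2) (q ^ 2) (m + 1))⁻¹
  have := tendsto_tsum_of_dominated_convergence hb hlim (Eventually.of_forall fun n => h n)
  rwa [tsum_ite_eq] at this

theorem qPochhammer_mul_eulerSum (hq : ‖q‖ < 1) (n : ℕ) :
    qPochhammer (-q) (q ^ 2) n * eulerSum q n = eulerSum q 0 := by
  induction n with
  | zero => simp
  | succ n ih => rw [← ih, eulerSum_succ hq n, qPochhammer_succ, mul_assoc]

/-- Euler's identity, obtained by iterating the step n ↦ n + 1 to the limit, where the sum tends to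
1. -/
theorem eulerSum_zero (hq : ‖q‖ < 1) : eulerSum q 0 = qPochhammerInf (-q) (q ^ 2) := by
  have h := (tendsto_qPochhammer (-q) (norm_sq_lt_one hq)).mul (tendsto_eulerSum hq)
  simp only [qPochhammer_mul_eulerSum hq, mul_one] at h
  exact tendsto_nhds_unique tendsto_const_nhds h

theorem summable_double_series (hq : ‖q‖ < 1) :
    Summable fun p : ℕ × ℕ => ‖q ^ (p.1 + p.2) ^ 2 *
      (qBinomCoeff q p.1 * (qPochhammer (q ^ 2) (q ^ 2) p.2)⁻¹)‖ := by
  obtain ⟨K, hK⟩ :=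
    exists_norm_inv_qPochhammer_le (norm_sq_lt_one hq) (one_sub_sq_mul_sq_pow_ne_zero hq)
  obtain ⟨L, hL⟩ := exists_norm_qPochhammer_le (-1) (norm_sq_lt_one hq)
  have hK0 : 0 ≤ K := (norm_nonneg _).trans (hK 0)
  have hL0 : 0 ≤ L := (norm_nonneg _).trans (hL 0)
  have hs := summable_geometric_of_lt_one (norm_nonneg q) hq
  have hs2 : Summable fun p : ℕ × ℕ => ‖q‖ ^ p.1 * ‖q‖ ^ p.2 :=
    hs.mul_of_nonneg hs (fun _ => by positivity) fun _ => by positivity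
  refine Summable.of_nonneg_of_le (fun _ => norm_nonneg _) (fun p => ?_) (hs2.mul_right (L * K * K))
  have h1 : ‖qBinomCoeff q p.1‖ ≤ L * K := by
    rw [qBinomCoeff, norm_mul, norm_mul, norm_pow]
    have : ‖q‖ ^ p.1 * ‖qPochhammer (-1) (q ^ 2) p.1‖ ≤ 1 * L :=
      mul_le_mul (pow_le_one₀ (norm_nonneg q) hq.le) (hL _) (norm_nonneg _) zero_le_one
    rw [one_mul] at this
    exact mul_le_mul this (hK _) (norm_nonneg _) hL0
  rw [norm_mul, norm_mul, norm_pow, ← pow_add]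
  exact mul_le_mul (pow_le_pow_of_le_one (norm_nonneg q) hq.le (Nat.le_self_pow two_ne_zero _))
    (mul_le_mul h1 (hK _) (norm_nonneg _) (by positivity)) (by positivity) (by positivity)

/-- The absolutely convergent double series is summed over m first, using (n+m)² = n² + (m² + 2nm).
In `hasSum_levelTwoCoeff` it is summed along antidiagonals instead. -/
theorem hasSum_qBinomCoeff_mul_eulerSum (hq : ‖q‖ < 1) :
    HasSum (fun n => q ^ n ^ 2 * qBinomCoeff q n * eulerSum q n)
      (∑' p : ℕ × ℕ, q ^ (p.1 + p.2) ^ 2 *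
        (qBinomCoeff q p.1 * (qPochhammer (q ^ 2) (q ^ 2) p.2)⁻¹)) := by
  refine (summable_double_series hq).of_norm.hasSum.prod_fiberwise fun n => ?_
  have h := (summable_eulerSum hq n).hasSum.mul_left (q ^ n ^ 2 * qBinomCoeff q n)
  refine h.congr_fun fun m => ?_
  ring

theorem hasSum_levelTwoCoeff (hq : ‖q‖ < 1) :
    HasSum (fun k => q ^ k ^ 2 * (levelTwoCoeff q k).1)
      (∑' p : ℕ × ℕ, q ^ (p.1 + p.2) ^ 2 *
        (qBinomCoeff q p.1 * (qPochhammer (q ^ 2) (q ^ 2) p.2)⁻¹)) := by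
  have h := (summable_double_series hq).of_norm.hasSum
  rw [← Finset.HasAntidiagonal.sigmaAntidiagonalEquivProd.hasSum_iff] at h
  refine h.sigma fun k => ?_
  have hk : q ^ k ^ 2 * (levelTwoCoeff q k).1 =
      ∑ p ∈ Finset.HasAntidiagonal.antidiagonal k, q ^ (p.1 + p.2) ^ 2 *
        (qBinomCoeff q p.1 * (qPochhammer (q ^ 2) (q ^ 2) p.2)⁻¹) := by
    rw [levelTwoCoeff_fst_eq hq, Finset.mul_sum]
    refine Finset.sum_congr rfl fun p hp => ?_
    rw [Finset.HasAntidiagonal.mem_antidiagonal.mp hp]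
  rw [hk, ← Finset.sum_finset_coe]
  exact hasSum_fintype _

/-- The coefficient is a convolution of a summable sequence with 1/(q;q)_n, which is bounded and
convergent, so dominated convergence applies. -/
theorem tendsto_coeff_numeratorA_mul (hq : ‖q‖ < 1) :
    Tendsto (fun N => PowerSeries.coeff N (numeratorA q * invQPochhammerSeries q)) atTop
      (𝓝 ((∑' k, q ^ k ^ 2 * (levelTwoCoeff q k).1) * (qPochhammerInf q q)⁻¹)) := by
  have hne : ∀ k, 1 - q * q ^ k ≠ 0 := one_sub_mul_pow_ne_zero hq hq
  obtain ⟨K, hK⟩ := exists_norm_inv_qPochhammer_le hq hne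
  have hlim := (tendsto_qPochhammer q hq).inv₀ (qPochhammerInf_ne_zero hq hne)
  have h := tendsto_tsum_of_dominated_convergence (𝓕 := atTop)
    (f := fun N k => if k ≤ N then
      q ^ k ^ 2 * (levelTwoCoeff q k).1 * (qPochhammer q q (N - k))⁻¹ else 0)
    (g := fun k => q ^ k ^ 2 * (levelTwoCoeff q k).1 * (qPochhammerInf q q)⁻¹)
    ((hasSum_levelTwoCoeff hq).summable.norm.mul_right K) (fun k => ?_)
    (Eventually.of_forall fun N k => ?_)
  · rw [tsum_mul_right] at h
    refine h.congr fun N => ?_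
    rw [PowerSeries.coeff_mul, Finset.Nat.sum_antidiagonal_eq_sum_range_succ_mk,
      tsum_eq_sum (s := Finset.range (N + 1)) fun k hk => if_neg (by simpa using hk)]
    refine Finset.sum_congr rfl fun k hk => ?_
    rw [if_pos (Nat.lt_succ_iff.mp (Finset.mem_range.mp hk))]
    simp [numeratorA, invQPochhammerSeries]
  · refine Tendsto.congr' ?_ ((hlim.comp (tendsto_sub_atTop_nat k)).const_mul _)
    filter_upwards [eventually_ge_atTop k] with N hN
    rw [if_pos hN]
    rfl
  · split_ifs
    · rw [norm_mul]
      exact mul_le_mul_of_nonneg_left (hK _) (norm_nonneg _)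
    · rw [norm_zero]
      exact mul_nonneg (norm_nonneg _) ((norm_nonneg _).trans (hK 0))

theorem levelTwoTerm_mul_eulerSum_zero (hq : ‖q‖ < 1) (n : ℕ) :
    q ^ (n + 1) ^ 2 * qBinomCoeff q (n + 1) * eulerSum q (n + 1) =
      levelTwoTerm q (n + 1) * eulerSum q 0 := by
  have h1 := qPochhammer_ne_zero (one_sub_sq_mul_sq_pow_ne_zero hq) (n + 1)
  have h2 := qPochhammer_ne_zero (one_sub_neg_mul_sq_pow_ne_zero hq) (n + 1)
  -- The first factor of (-1;q²)_(n+1) is 2, the source of the 2 in the series; what is left is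
  -- (-q²;q²)_n.
  rw [← qPochhammer_mul_eulerSum hq (n + 1), levelTwoTerm, qBinomCoeff, Nat.add_sub_cancel,
    qPochhammer_succ' (-1), neg_one_mul]
  field_simp
  ring

theorem hasSum_levelTwoTerm (hq : ‖q‖ < 1) :
    HasSum (fun n => levelTwoTerm q (n + 1))
      ((∑' k, q ^ k ^ 2 * (levelTwoCoeff q k).1) * (qPochhammerInf (-q) (q ^ 2))⁻¹ - 1) := by
  have hE : eulerSum q 0 ≠ 0 := by
    rw [eulerSum_zero hq]
    exact qPochhammerInf_ne_zero (norm_sq_lt_one hq) (one_sub_neg_mul_sq_pow_ne_zero hq)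
  have h := hasSum_qBinomCoeff_mul_eulerSum hq
  -- The n = 0 term is split off because it lacks the factor 2; after division by `eulerSum q 0` it
  -- is the 1 subtracted in the claim.
  rw [← (hasSum_levelTwoCoeff hq).tsum_eq, ← hasSum_nat_add_iff' 1] at h
  simp only [levelTwoTerm_mul_eulerSum_zero hq] at h
  have h' := h.mul_right (eulerSum q 0)⁻¹
  simp only [mul_inv_cancel_right₀ hE] at h'
  rw [← eulerSum_zero hq]
  simpa [qBinomCoeff, sub_mul, hE] using h'

end Evaluation

/-- For every complex `q` with `|q| < 1`, the generating function of cylindric partitions with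
profile `(1, 0, 1, 0)` converges, all expressions on the right-hand side make sense (no
denominator vanishes, and the infinite products and the series converge), and the two sides
are equal. -/
theorem mainTheorem11 (q : ℂ) (hq : ‖q‖ < 1) :
    Summable (fun Λ : CylindricPartition ![1, 0, 1, 0] =>
      (1 : ℂ) ^ Λ.maxPart * q ^ Λ.size) ∧
    (∀ n : ℕ, qPochhammer (q ^ 2) (q ^ 2) n * qPochhammer (-q) (q ^ 2) n ≠ 0) ∧
    Summable (fun n : ℕ => levelTwoTerm q (n + 1)) ∧
    Tendsto (qPochhammer (-q) (q ^ 2)) atTop (𝓝 (qPochhammerInf (-q) (q ^ 2))) ∧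
    Tendsto (qPochhammer q q) atTop (𝓝 (qPochhammerInf q q)) ∧
    qPochhammerInf q q ≠ 0 ∧
    cylindricGenFun ![1, 0, 1, 0] 1 q =
      (1 + ∑' n : ℕ, levelTwoTerm q (n + 1)) *
        (qPochhammerInf (-q) (q ^ 2) / qPochhammerInf q q) := by
  have hE := qPochhammerInf_ne_zero (norm_sq_lt_one hq) (one_sub_neg_mul_sq_pow_ne_zero hq)
  refine ⟨?_, fun n => mul_ne_zero (qPochhammer_ne_zero (one_sub_sq_mul_sq_pow_ne_zero hq) n)
      (qPochhammer_ne_zero (one_sub_neg_mul_sq_pow_ne_zero hq) n),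
    (hasSum_levelTwoTerm hq).summable, tendsto_qPochhammer _ (norm_sq_lt_one hq),
    tendsto_qPochhammer _ hq, qPochhammerInf_ne_zero hq (one_sub_mul_pow_ne_zero hq hq), ?_⟩
  · simpa only [one_pow, one_mul] using (CylindricPartition.summable_norm_pow_size hq).of_norm
  · have hcoeff := eq_coeff_of_recurrence hq
      (CylindricPartition.leadingGenFun_zero _ q) (CylindricPartition.leadingGenFun_zero _ q)
      (CylindricPartition.leadingGenFun_zero _ q) (CylindricPartition.leadingGenFun_2000 hq)
      (CylindricPartition.leadingGenFun_1100 hq) (CylindricPartition.leadingGenFun_1010 hq)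
    have hlim := (tendsto_coeff_numeratorA_mul hq).congr fun N => (hcoeff N).symm
    have hF := tendsto_nhds_unique (CylindricPartition.tendsto_leadingGenFun ![1, 0, 1, 0] hq) hlim
    simp only [cylindricGenFun, one_pow, one_mul]
    rw [hF, (hasSum_levelTwoTerm hq).tsum_eq, add_sub_cancel, div_eq_mul_inv, mul_assoc,
      inv_mul_cancel_left₀ hE]
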